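/- Theorem (PAC-Bayes-NTK). Let $f:\mathbb{R}^D\times\mathbb{R}^P\to\mathbb{R}^K$ be a measurable network, $\mathrm{err}:\mathbb{R}^K\times\mathbb{R}^K\to[0,1]$ a measurable error function, $\mathcal{D}$ a probability distribution on $\mathbb{R}^D\times\mathbb{R}^K$, and let $\alpha,\sigma>0$, $\delta\in(0,1]$. Let the training data $\mathcal{S}$ be drawn i.i.d. from $\mathcal{D}$ and split into disjoint parts $\mathcal{S}_{\mathbb{P}}$ of size $N_{\mathbb{P}}\ge 0$ and $\mathcal{S}_{\mathbb{Q}}$ of size $N_{\mathbb{Q}}\ge 1$. Let $\theta^*\in\mathbb{R}^P$ be a parameter pre-trained on $\mathcal{S}_{\mathbb{P}}$, that is, a random parameter (for instance a possibly randomized function of $\mathcal{S}_{\mathbb{P}}$) that is independent of $\mathcal{S}_{\mathbb{Q}}$. Let $\mathcal{R}\subseteq\mathcal{S}$ be the part of the data that is used to build the posterior, chosen by a fixed set of indices (e.g. $\mathcal{R}=\mathcal{S}$, or $\mathcal{R}=\mathcal{S}_{\mathbb{Q}}$), and assume that almost surely $f(x,\cdot)$ is differentiable at $\theta^*$ for every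 input $x$ of $\mathcal{R}$. Write $\mathcal{X},\mathcal{Y}$ for the concatenated inputs and outputs of $\mathcal{R}$ and $\mathbf{J}_\theta\in\mathbb{R}^{|\mathcal{R}|K\times P}$ for the concatenation of the Jacobians $\partial_\theta f(x,\theta^*)$ along $\mathcal{X}$. Define distributions of a perturbation $v\in\mathbb{R}^P$ of $\theta^*$ by $$\mathbb{P}'=\mathcal{N}(0,\alpha^2\mathbf{I}_P),\quad \mathbb{Q}'=\mathcal{N}(\mu',\Sigma'),\quad \Sigma'=\Big(\frac{\mathbf{I}_P}{\alpha^2}+\frac{\mathbf{J}_\theta^\top\mathbf{J}_\theta}{\sigma^2}\Big)^{-1},\quad \mu'=\frac{\Sigma'\mathbf{J}_\theta^\top(\mathcal{Y}-f(\mathcal{X},\theta^*))}{\sigma^2}.$$ Let $\mathrm{err}_{\mathcal{D}}(\mathbb{Q}')=\mathbb{E}_{(x,y)\sim\mathcal{D},\,v\sim\mathbb{Q}'}[\mathrm{err}(f(x,\theta^*+v),y)]$, let $\mathrm{err}_{\mathcal{S}_{\mathbb{Q}}}(\mathbb{Q}')$ be the same quantity with $\mathcal{D}$ replaced by the empirical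 distribution of $\mathcal{S}_{\mathbb{Q}}$, let $\beta'_1,\dots,\beta'_P$ be the eigenvalues of $(\mathbf{I}_P+\frac{\alpha^2}{\sigma^2}\mathbf{J}_\theta^\top\mathbf{J}_\theta)^{-1}$ (with multiplicity), and $h(x)=x-\log x-1$. Then: (1) With probability at least $1-\delta$, $$\mathrm{err}_{\mathcal{D}}(\mathbb{Q}')\le \mathrm{err}_{\mathcal{S}_{\mathbb{Q}}}(\mathbb{Q}')+\sqrt{\frac{\mu'^\top\mu'}{4\alpha^2N_{\mathbb{Q}}}+\sum_{i=1}^P\frac{h(\beta'_i)}{4N_{\mathbb{Q}}}+\frac{\log(2\sqrt{N_{\mathbb{Q}}}/\delta)}{2N_{\mathbb{Q}}}}.$$ (2) Almost surely, the first two terms under the root are the KL-divergence term: $\mathrm{KL}[\mathbb{Q}'\|\mathbb{P}']=\frac{\mu'^\top\mu'}{2\alpha^2}+\frac12\sum_{i=1}^P h(\beta'_i)$. Moreover $\beta'_i=\sigma^2/(\sigma^2+\alpha^2\lambda'_i)$ for $i=1,\dots,P$, where $\lambda'_1,\dots,\lambda'_P$ are the eigenvalues of the empirical NTK $\mathbf{J}_\theta\mathbf{J}_\theta^\top$,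 in the sense that every non-zero number occurs among the $\lambda'_i$ exactly as often as it occurs as an eigenvalue of $\mathbf{J}_\theta\mathbf{J}_\theta^\top$ (the remaining $\lambda'_i$ are $0$). (3) The upper bound in (1) is not scale-invariant in general: whenever $K\ge1$ and $\mathcal{R}$ is non-empty, and for all $D,N_{\mathbb{P}},N_{\mathbb{Q}},\alpha,\sigma,\delta$ as above, there are a number of parameters $P$, a smooth network $f$, a measurable error function $\mathrm{err}$ with values in $[0,1]$, an invertible diagonal linear map $\mathcal{T}$ on $\mathbb{R}^P$ with $f(x,\mathcal{T}(\psi))=f(x,\psi)$ for all $x,\psi$, a data set $\mathcal{S}$ and a parameter $\theta$ such that the right-hand side of (1) takes different values at $\theta^*=\mathcal{T}(\theta)$ and at $\theta^*=\theta$. -/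

import Mathlib

open MeasureTheory ProbabilityTheory InformationTheory

noncomputable section

namespace PacBayesNTK

/-- Euclidean space of dimension `n`. -/
abbrev Vec (n : ℕ) : Type := EuclideanSpace ℝ (Fin n)

/-- The Jacobian of `θ ↦ f(x, θ)` at the parameter `θ`, a `K × P` matrix. -/
def jacobian {D P K : ℕ} (f : Vec D → Vec P → Vec K) (x : Vec D) (θ : Vec P) :
    Matrix (Fin K) (Fin P) ℝ :=
  Matrix.of fun k p => (fderiv ℝ (f x) θ (EuclideanSpace.single p 1)) k

/-- The concatenation of the Jacobians `J_θ(x, θ)` along the inputs of the finite data set `z`. -/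
def stackedJacobian {D P K : ℕ} {ι : Type*} (f : Vec D → Vec P → Vec K)
    (z : ι → Vec D × Vec K) (θ : Vec P) : Matrix (ι × Fin K) (Fin P) ℝ :=
  Matrix.of fun i p => jacobian f (z i.1).1 θ i.2 p

/-- The concatenated residuals `𝒴 - f(𝒳, θ)` of the finite data set `z`. -/
def residual {D P K : ℕ} {ι : Type*} (f : Vec D → Vec P → Vec K)
    (z : ι → Vec D × Vec K) (θ : Vec P) : ι × Fin K → ℝ :=
  fun i => (z i.1).2 i.2 - f (z i.1).1 θ i.2

/-- The empirical neural tangent kernel matrix `J Jᵀ` belonging to a stacked Jacobian `J`. -/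
def ntk {P : ℕ} {κ : Type*} (J : Matrix κ (Fin P) ℝ) : Matrix κ κ ℝ :=
  J * J.transpose

theorem ntk_isHermitian {P : ℕ} {κ : Type*} (J : Matrix κ (Fin P) ℝ) :
    (ntk J).IsHermitian := by
  have h := Matrix.isHermitian_mul_conjTranspose_self J
  rwa [Matrix.conjTranspose_eq_transpose_of_trivial] at h

/-- The eigenvalues of the empirical NTK, with multiplicity. -/
def ntkEigenvalues {P : ℕ} {κ : Type*} [Fintype κ] [DecidableEq κ]
    (J : Matrix κ (Fin P) ℝ) : κ → ℝ :=
  (ntk_isHermitian J).eigenvalues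

/-- The covariance `(I / α² + Jᵀ J / σ²)⁻¹` of the posterior. -/
def posteriorCov {P : ℕ} {κ : Type*} [Fintype κ] (α σ : ℝ) (J : Matrix κ (Fin P) ℝ) :
    Matrix (Fin P) (Fin P) ℝ :=
  ((1 / α ^ 2) • (1 : Matrix (Fin P) (Fin P) ℝ) + (1 / σ ^ 2) • (J.transpose * J))⁻¹

/-- The mean `Σ Jᵀ r / σ²` of the posterior, where `r` is the vector of residuals. -/
def posteriorMean {P : ℕ} {κ : Type*} [Fintype κ] (α σ : ℝ) (J : Matrix κ (Fin P) ℝ)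
    (r : κ → ℝ) : Fin P → ℝ :=
  (1 / σ ^ 2) • (posteriorCov α σ J).mulVec (J.transpose.mulVec r)

/-- The prior `N(0, α² I)` over perturbations of the parameter. -/
def prior (P : ℕ) (α : ℝ) : Measure (Vec P) :=
  multivariateGaussian 0 (α ^ 2 • (1 : Matrix (Fin P) (Fin P) ℝ))

/-- The posterior `N(μ, Σ)` over perturbations of the parameter `θ`, built from the data `z`. -/
def posterior {D P K : ℕ} {ι : Type*} [Fintype ι] (α σ : ℝ) (f : Vec D → Vec P → Vec K)
    (z : ι → Vec D × Vec K) (θ : Vec P) : Measure (Vec P) :=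
  multivariateGaussian
    (WithLp.toLp 2 (posteriorMean α σ (stackedJacobian f z θ) (residual f z θ)))
    (posteriorCov α σ (stackedJacobian f z θ))

/-- The matrix `(I + (α² / σ²) Jᵀ J)⁻¹`. -/
def sharpnessMatrix {P : ℕ} {κ : Type*} [Fintype κ] (α σ : ℝ) (J : Matrix κ (Fin P) ℝ) :
    Matrix (Fin P) (Fin P) ℝ :=
  (1 + (α ^ 2 / σ ^ 2) • (J.transpose * J))⁻¹

theorem sharpnessMatrix_isHermitian {P : ℕ} {κ : Type*} [Fintype κ] (α σ : ℝ)
    (J : Matrix κ (Fin P) ℝ) : (sharpnessMatrix α σ J).IsHermitian := by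
  unfold sharpnessMatrix
  apply Matrix.IsHermitian.inv
  apply Matrix.IsHermitian.add Matrix.isHermitian_one
  have h := Matrix.isHermitian_conjTranspose_mul_self J
  rw [Matrix.conjTranspose_eq_transpose_of_trivial] at h
  unfold Matrix.IsHermitian at h ⊢
  rw [Matrix.conjTranspose_smul, h, star_trivial]

/-- The eigenvalues `β'_1, …, β'_P` of `(I + (α² / σ²) Jᵀ J)⁻¹`, with multiplicity. -/
def beta {P : ℕ} {κ : Type*} [Fintype κ] (α σ : ℝ) (J : Matrix κ (Fin P) ℝ) : Fin P → ℝ :=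
  (sharpnessMatrix_isHermitian α σ J).eigenvalues

/-- `h(x) = x - log x - 1`. -/
def h (x : ℝ) : ℝ := x - Real.log x - 1

/-- The generalization error `E_{(x, y) ∼ 𝒟, v ∼ Q} err(f(x, θ + v), y)` of a distribution `Q` over
perturbations `v` of the parameter `θ`. -/
def genError {D P K : ℕ} (err : Vec K → Vec K → ℝ) (f : Vec D → Vec P → Vec K)
    (𝒟 : Measure (Vec D × Vec K)) (θ : Vec P) (Q : Measure (Vec P)) : ℝ :=
  ∫ p, err (f p.1.1 (θ + p.2)) p.1.2 ∂(𝒟.prod Q)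

/-- The empirical error of a distribution `Q` over perturbations `v` of the parameter `θ`, on a
sample `z` of size `N`. -/
def empError {D P K N : ℕ} (err : Vec K → Vec K → ℝ) (f : Vec D → Vec P → Vec K)
    (z : Fin N → Vec D × Vec K) (θ : Vec P) (Q : Measure (Vec P)) : ℝ :=
  (1 / (N : ℝ)) * ∑ n, ∫ v, err (f (z n).1 (θ + v)) (z n).2 ∂Q

/-- The sub-sample with index set `R` of the data set `s = S_P ∪ S_Q`. -/
def subSample {D K NP NQ : ℕ} (R : Finset (Fin NP ⊕ Fin NQ))
    (s : Fin NP ⊕ Fin NQ → Vec D × Vec K) : R → Vec D × Vec K :=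
  fun i => s i

/-- The PAC-Bayes-NTK upper bound at the parameter `θ` for the data `s = S_P ∪ S_Q`. The posterior
is built from the data with index in `R`; the empirical error is taken on `S_Q`. -/
def upperBound {D P K NP NQ : ℕ} (α σ δ : ℝ) (err : Vec K → Vec K → ℝ)
    (f : Vec D → Vec P → Vec K) (R : Finset (Fin NP ⊕ Fin NQ))
    (s : Fin NP ⊕ Fin NQ → Vec D × Vec K) (θ : Vec P) : ℝ :=
  let z := subSample R s
  let J := stackedJacobian f z θ
  let m := posteriorMean α σ J (residual f z θ)
  empError err f (fun n => s (Sum.inr n)) θ (posterior α σ f z θ) +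
    Real.sqrt
      (dotProduct m m / (4 * α ^ 2 * NQ) +
        (∑ i, h (beta α σ J i) / (4 * NQ)) +
        Real.log (2 * Real.sqrt NQ / δ) / (2 * NQ))

/-- The diagonal linear map with diagonal entries `t`. -/
def diagScale {P : ℕ} (t : Fin P → ℝ) (ψ : Vec P) : Vec P :=
  WithLp.toLp 2 fun i => t i * ψ i

/-- The diagonal linear map with entries `t` is invertible and preserves the function `f`. -/
def IsFunctionPreserving {D P K : ℕ} (f : Vec D → Vec P → Vec K) (t : Fin P → ℝ) : Prop :=
  (∀ i, t i ≠ 0) ∧ ∀ x ψ, f x (diagScale t ψ) = f x ψ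

end PacBayesNTK

end

noncomputable section

namespace PacBayesNTK

/-! The bound is a PAC-Bayes inequality with the inverse temperature `l` mixed over an interval. For
a fixed parameter, Hoeffding's lemma shows that exp(l·gap - l²/(8N)) has expectation at most 1 over
the sample. Integrating over `l` in (0, 4N] (Lebesgue) and over the prior gives a mixture with
expectation at most 4N, which by Markov lies below 4N/δ with probability at least 1 - δ. The
pre-trained parameter may be random because it is independent of the sample and can be held fixed in
this estimate (`exists_event_lt_of_lintegral_le`).

On that event everything is deterministic. If x is the posterior mean of the gap, Donsker-Varadhan
(`exp_integral_le_exp_klDiv_mul`) bounds exp(l x - l²/(8N)) by exp(KL) times the prior moment.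
Integrating over `l`, the left side is at least 2√N·exp(2N x²) for 0 ≤ x ≤ 1
(`exp_two_mul_sq_le_integral`), so 2N x² ≤ KL + log(2√N/δ). The event does not depend on the
posterior, which may therefore be built from the same sample.

The KL term is explicit because the prior is isotropic: in an orthonormal eigenbasis of the
posterior covariance both Gaussians are products, and the divergence is a sum of one-dimensional
ones (`klDiv_multivariateGaussian_prior`). The β' are tied to the NTK through the common non-zero
spectrum of JᵀJ and JJᵀ. Scale dependence is witnessed by the product of two parameters, at a point
where only the sharpness term is sensitive to the scaling. -/

/-! ### Gaussian integral over the inverse temperature, and change of measure -/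

/-- Square of 1 - t ≤ exp(-t) at t = u²/4; the hypothesis makes the left side non-negative. Squaring
keeps enough mass: integrating 1 - u²/2 over [0, 2] would give less than 1. -/
lemma one_sub_sq_div_four_sq_le_exp {u : ℝ} (hu : u ^ 2 ≤ 4) :
    (1 - u ^ 2 / 4) ^ 2 ≤ Real.exp (-(u ^ 2 / 2)) := by
  have h1 := Real.add_one_le_exp (-(u ^ 2 / 4))
  have h2 : Real.exp (-(u ^ 2 / 2)) = Real.exp (-(u ^ 2 / 4)) ^ 2 := by
    rw [← Real.exp_nat_mul]; congr 1; push_cast; ring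
  rw [h2]
  exact pow_le_pow_left₀ (by linarith) (by linarith) 2

lemma integral_poly_le_integral_exp {p q : ℝ} (hp : 0 ≤ p) (hq : 0 ≤ q) (hp2 : p ≤ 2)
    (hq2 : q ≤ 2) :
    (q - q ^ 3 / 6 + q ^ 5 / 80) + (p - p ^ 3 / 6 + p ^ 5 / 80) ≤
      ∫ u in (-p)..q, Real.exp (-(u ^ 2 / 2)) := by
  have h1 : ∫ u in (-p)..q, (1 - u ^ 2 / 4) ^ 2 =
      (q - q ^ 3 / 6 + q ^ 5 / 80) + (p - p ^ 3 / 6 + p ^ 5 / 80) := by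
    rw [intervalIntegral.integral_eq_sub_of_hasDerivAt
      (f := fun u => u - u ^ 3 / 6 + u ^ 5 / 80)]
    · ring
    · intro x _
      exact (((hasDerivAt_id' x).sub ((hasDerivAt_pow 3 x).div_const 6)).add
        ((hasDerivAt_pow 5 x).div_const 80)).congr_deriv (by push_cast; ring)
    · exact (by fun_prop : Continuous fun u : ℝ => (1 - u ^ 2 / 4) ^ 2).intervalIntegrable _ _
  rw [← h1]
  apply intervalIntegral.integral_mono_on (by linarith)
  · exact (by fun_prop : Continuous fun u : ℝ => (1 - u ^ 2 / 4) ^ 2).intervalIntegrable _ _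
  · exact (by fun_prop :
      Continuous fun u : ℝ => Real.exp (-(u ^ 2 / 2))).intervalIntegrable _ _
  · intro u hu
    apply one_sub_sq_div_four_sq_le_exp
    nlinarith [hu.1, hu.2]

/-- The unnormalized Gaussian density has integral at least one over every interval around zero
of length at least two. -/
lemma one_le_integral_exp_neg_sq {p q : ℝ} (hp : 0 ≤ p) (hq : 0 ≤ q) (hpq : 2 ≤ p + q) :
    1 ≤ ∫ u in (-p)..q, Real.exp (-(u ^ 2 / 2)) := by
  have hmono : ∀ p' q' : ℝ, 0 ≤ p' → 0 ≤ q' → p' ≤ p → q' ≤ q →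
      ∫ u in (-p')..q', Real.exp (-(u ^ 2 / 2)) ≤ ∫ u in (-p)..q, Real.exp (-(u ^ 2 / 2)) := by
    intro p' q' h1 h2 h3 h4
    apply intervalIntegral.integral_mono_interval (by linarith) (by linarith) h4
    · exact Filter.Eventually.of_forall fun x => (Real.exp_pos _).le
    · exact (by fun_prop :
        Continuous fun u : ℝ => Real.exp (-(u ^ 2 / 2))).intervalIntegrable _ _
  -- Shrinking to length exactly 2 keeps both endpoints in the range where the polynomial minorant
  -- is valid.
  obtain ⟨p', q', h1, h2, h3, h4, h5⟩ : ∃ p' q' : ℝ, 0 ≤ p' ∧ 0 ≤ q' ∧ p' ≤ p ∧ q' ≤ q ∧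
      p' + q' = 2 := by
    rcases le_total q 2 with h | h
    · exact ⟨2 - q, q, by linarith, hq, by linarith, le_rfl, by ring⟩
    · exact ⟨0, 2, le_rfl, by norm_num, hp, h, by norm_num⟩
  refine le_trans ?_ ((integral_poly_le_integral_exp h1 h2 (by linarith) (by linarith)).trans
    (hmono p' q' h1 h2 h3 h4))
  obtain rfl : p' = 2 - q' := by linarith
  -- With w = p'q' and p' + q' = 2, the polynomial equals 16/15 + w/2 + w²/8.
  nlinarith [mul_nonneg h1 h2, sq_nonneg ((2 - q') * q')]

/-- Completing the square with u = l/(2√n) - 2√n x turns the exponent into 2n x² - u²/2. The upper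
limit 4n makes u range over an interval around 0 of length 2√n ≥ 2, whatever x in [0, 1]; the
prefactor 2√n is the Jacobian. -/
lemma exp_two_mul_sq_le_integral {n x : ℝ} (hn : 1 ≤ n) (hx0 : 0 ≤ x) (hx1 : x ≤ 1) :
    2 * Real.sqrt n * Real.exp (2 * n * x ^ 2) ≤
      ∫ l in (0 : ℝ)..(4 * n), Real.exp (l * x - l ^ 2 / (8 * n)) := by
  set c := Real.sqrt n with hc
  have hc1 : 1 ≤ c := Real.one_le_sqrt.2 hn
  have hcn : n = c ^ 2 := (Real.sq_sqrt (by linarith)).symm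
  have hc0 : (2 * c) ≠ 0 := by positivity
  have h1 : ∀ l : ℝ, Real.exp (l * x - l ^ 2 / (8 * n)) = Real.exp (2 * n * x ^ 2) *
      (fun u => Real.exp (-(u ^ 2 / 2))) (l / (2 * c) - 2 * c * x) := by
    intro l
    simp only
    rw [← Real.exp_add, hcn]
    congr 1
    field_simp
    ring
  simp_rw [h1]
  rw [intervalIntegral.integral_const_mul,
    intervalIntegral.integral_comp_div_sub (fun u => Real.exp (-(u ^ 2 / 2))) hc0, smul_eq_mul]
  have h2 : (0 : ℝ) / (2 * c) - 2 * c * x = -(2 * c * x) := by ring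
  have h3 : 4 * n / (2 * c) - 2 * c * x = 2 * c * (1 - x) := by
    rw [hcn]; field_simp; ring
  rw [h2, h3]
  have h4 := one_le_integral_exp_neg_sq (p := 2 * c * x) (q := 2 * c * (1 - x)) (by positivity)
    (mul_nonneg (by positivity) (by linarith)) (by nlinarith)
  have := Real.exp_pos (2 * n * x ^ 2)
  calc 2 * c * Real.exp (2 * n * x ^ 2) = Real.exp (2 * n * x ^ 2) * (2 * c * 1) := by ring
    _ ≤ _ := by gcongr

/-- The Donsker-Varadhan change of measure. -/
lemma exp_integral_le_exp_klDiv_mul {E : Type*} [MeasurableSpace E] {Q P : Measure E}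
    [IsProbabilityMeasure Q] [IsProbabilityMeasure P] (hKL : klDiv Q P ≠ ⊤) {g : E → ℝ}
    (hg : Measurable g) {C : ℝ} (hgC : ∀ v, |g v| ≤ C) :
    Real.exp (∫ v, g v ∂Q) ≤ Real.exp (klDiv Q P).toReal * ∫ v, Real.exp (g v) ∂P := by
  obtain ⟨hac, hint⟩ := klDiv_ne_top_iff.1 hKL
  have hgQ : Integrable g Q := .of_bound hg.aestronglyMeasurable C (.of_forall hgC)
  have hgP : Integrable (fun v => Real.exp (g v)) P := by
    refine .of_bound (hg.exp).aestronglyMeasurable (Real.exp C) (.of_forall fun v => ?_)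
    rw [Real.norm_eq_abs, Real.abs_exp]
    exact Real.exp_le_exp.2 ((le_abs_self _).trans (hgC v))
  -- Gibbs' inequality for `Q` against `P.tilted g`: the divergence KL(Q‖P) - ∫ g dQ + log ∫ exp g
  -- dP is non-negative.
  have h1 := integral_llr_tilted_right hac hgQ hgP hint
  have : IsProbabilityMeasure (P.tilted g) := isProbabilityMeasure_tilted hgP
  have h2 := integral_llr_add_sub_measure_univ_nonneg
    (hac.trans (absolutelyContinuous_tilted hgP)) (integrable_llr_tilted_right hac hgQ hint hgP)
  simp only [probReal_univ, add_sub_cancel_right, h1] at h2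
  rw [toReal_klDiv_of_measure_eq hac (by simp)]
  have hpos : 0 < ∫ v, Real.exp (g v) ∂P := integral_exp_pos hgP
  rw [← Real.exp_log hpos, ← Real.exp_add]
  exact Real.exp_le_exp.2 (by linarith)

/-! ### Risk gap and its exponential moments -/

section PacBayes

variable {Θ Z : Type*} [MeasurableSpace Θ] [MeasurableSpace Z] {N : ℕ}

/-- The gap between the risk and the empirical risk of `θ` on the sample `s`. -/
def riskGap (ℓ : Θ → Z → ℝ) (𝒟 : Measure Z) (s : Fin N → Z) (θ : Θ) : ℝ :=
  ∫ z, ℓ θ z ∂𝒟 - (1 / (N : ℝ)) * ∑ n, ℓ θ (s n)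

variable {ℓ : Θ → Z → ℝ} {𝒟 : Measure Z} [IsProbabilityMeasure 𝒟]

lemma measurable_risk (hℓ : Measurable (Function.uncurry ℓ)) :
    Measurable fun θ => ∫ z, ℓ θ z ∂𝒟 :=
  (StronglyMeasurable.integral_prod_right (f := ℓ) hℓ.stronglyMeasurable).measurable

lemma measurable_riskGap (hℓ : Measurable (Function.uncurry ℓ)) :
    Measurable fun p : (Fin N → Z) × Θ => riskGap ℓ 𝒟 p.1 p.2 := by
  unfold riskGap
  refine ((measurable_risk hℓ).comp measurable_snd).sub (measurable_const.mul
    (Finset.measurable_sum _ fun n _ => ?_))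
  exact hℓ.comp (measurable_snd.prodMk ((measurable_pi_apply n).comp measurable_fst))

lemma integrable_of_mem_Icc {E : Type*} [MeasurableSpace E] {ν : Measure E} [IsFiniteMeasure ν]
    {g : E → ℝ} (hg : Measurable g) (h : ∀ x, g x ∈ Set.Icc (0 : ℝ) 1) : Integrable g ν := by
  refine .of_bound hg.aestronglyMeasurable 1 (.of_forall fun x => ?_)
  rw [Real.norm_eq_abs, abs_le]
  exact ⟨by linarith [(h x).1], (h x).2⟩

lemma integral_mem_Icc {E : Type*} [MeasurableSpace E] {ν : Measure E} [IsProbabilityMeasure ν]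
    {g : E → ℝ} (hg : Measurable g) (h : ∀ x, g x ∈ Set.Icc (0 : ℝ) 1) :
    ∫ x, g x ∂ν ∈ Set.Icc (0 : ℝ) 1 := by
  refine ⟨integral_nonneg fun x => (h x).1, ?_⟩
  calc ∫ x, g x ∂ν ≤ ∫ _, (1 : ℝ) ∂ν :=
        integral_mono (integrable_of_mem_Icc hg h) (integrable_const _) fun x => (h x).2
    _ = 1 := by simp

lemma empiricalMean_mem_Icc (hN : 0 < N) {a : Fin N → ℝ} (ha : ∀ n, a n ∈ Set.Icc (0 : ℝ) 1) :
    (1 / (N : ℝ)) * ∑ n, a n ∈ Set.Icc (0 : ℝ) 1 := by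
  have hN' : (0 : ℝ) < N := by exact_mod_cast hN
  have h0 : 0 ≤ ∑ n, a n := Finset.sum_nonneg fun n _ => (ha n).1
  have h1 : ∑ n, a n ≤ N := by
    calc ∑ n, a n ≤ ∑ _n : Fin N, (1 : ℝ) := Finset.sum_le_sum fun n _ => (ha n).2
      _ = N := by simp
  refine ⟨by positivity, ?_⟩
  rw [one_div, inv_mul_le_iff₀ hN']
  linarith

lemma abs_riskGap_le_one (hN : 0 < N) (hℓ : Measurable (Function.uncurry ℓ))
    (hℓ01 : ∀ θ z, ℓ θ z ∈ Set.Icc (0 : ℝ) 1) (s : Fin N → Z) (θ : Θ) :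
    |riskGap ℓ 𝒟 s θ| ≤ 1 := by
  have h1 := integral_mem_Icc (ν := 𝒟) hℓ.of_uncurry_left (hℓ01 θ)
  have h2 := empiricalMean_mem_Icc hN fun n => hℓ01 θ (s n)
  rw [riskGap, abs_le]
  exact ⟨by linarith [h1.1, h2.2], by linarith [h1.2, h2.1]⟩

lemma integrable_exp_riskGap (hN : 0 < N) (hℓ : Measurable (Function.uncurry ℓ))
    (hℓ01 : ∀ θ z, ℓ θ z ∈ Set.Icc (0 : ℝ) 1) (θ : Θ) (l : ℝ) :
    Integrable (fun s : Fin N → Z => Real.exp (l * riskGap ℓ 𝒟 s θ))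
      (Measure.pi fun _ => 𝒟) := by
  have hm : Measurable fun s : Fin N → Z => riskGap ℓ 𝒟 s θ :=
    (measurable_riskGap hℓ).comp (measurable_id.prodMk measurable_const)
  refine .of_bound (hm.const_mul l).exp.aestronglyMeasurable (Real.exp |l|)
    (.of_forall fun s => ?_)
  rw [Real.norm_eq_abs, Real.abs_exp, Real.exp_le_exp]
  calc l * riskGap ℓ 𝒟 s θ ≤ |l * riskGap ℓ 𝒟 s θ| := le_abs_self _
    _ = |l| * |riskGap ℓ 𝒟 s θ| := abs_mul _ _
    _ ≤ |l| * 1 := by gcongr; exact abs_riskGap_le_one hN hℓ hℓ01 s θ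
    _ = |l| := mul_one _

/-- Hoeffding's lemma gives each centred loss the variance proxy 1/4, and independence gives their
sum N/4. The gap is -1/N times that sum, so its moment is the mgf at -l/N, with exponent
(N/4)(l/N)²/2. -/
lemma integral_exp_riskGap_le (hN : 0 < N) (hℓ : Measurable (Function.uncurry ℓ))
    (hℓ01 : ∀ θ z, ℓ θ z ∈ Set.Icc (0 : ℝ) 1) (θ : Θ) (l : ℝ) :
    ∫ s : Fin N → Z, Real.exp (l * riskGap ℓ 𝒟 s θ) ∂(Measure.pi fun _ => 𝒟) ≤
      Real.exp (l ^ 2 / (8 * N)) := by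
  have hN' : (0 : ℝ) < N := by exact_mod_cast hN
  have hm : Measurable (ℓ θ) := hℓ.of_uncurry_left
  have hsub := hasSubgaussianMGF_of_mem_Icc (μ := 𝒟) hm.aemeasurable (.of_forall (hℓ01 θ))
  set r := ∫ z, ℓ θ z ∂𝒟 with hr
  have hm' : Measurable fun z => ℓ θ z - r := hm.sub_const r
  have hind : iIndepFun (fun (n : Fin N) (s : Fin N → Z) => ℓ θ (s n) - r)
      (Measure.pi fun _ => 𝒟) :=
    iIndepFun_pi (X := fun _ z => ℓ θ z - r) fun _ => hm'.aemeasurable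
  have hsum := (HasSubgaussianMGF.sum_of_iIndepFun hind (s := Finset.univ)
    (c := fun _ => (‖(1 : ℝ) - 0‖₊ / 2) ^ 2) fun n _ => by
      refine HasSubgaussianMGF.of_map (Y := fun s : Fin N → Z => s n) (X := fun z => ℓ θ z - r)
        (measurable_pi_apply n).aemeasurable ?_
      rwa [(measurePreserving_eval (fun _ : Fin N => 𝒟) n).map_eq]).mgf_le (-(l / N))
  rw [mgf] at hsum
  convert hsum using 2
  · ext s
    congr 1
    rw [riskGap, ← hr, Finset.sum_sub_distrib]
    simp
    field_simp
    ring
  · simp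
    field_simp
    ring

end PacBayes

/-- Markov's inequality for a functional of a random parameter and an independent i.i.d. sample. -/
lemma exists_event_lt_of_lintegral_le {Θ Z : Type*} [MeasurableSpace Θ] [MeasurableSpace Z]
    {N : ℕ} {𝒟 : Measure Z} [IsProbabilityMeasure 𝒟] {T : Θ × (Fin N → Z) → ENNReal}
    (hTm : Measurable T) {c δ : ℝ} (hc : 0 < c) (hδ : 0 < δ)
    (hTc : ∀ θ, ∫⁻ s, T (θ, s) ∂(Measure.pi fun _ => 𝒟) ≤ ENNReal.ofReal c)
    {Ω : Type*} [MeasurableSpace Ω] (μ : Measure Ω) [IsProbabilityMeasure μ]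
    {S : Fin N → Ω → Z} (hS : ∀ i, Measurable (S i)) (hSindep : iIndepFun S μ)
    (hSlaw : ∀ i, μ.map (S i) = 𝒟) {θ : Ω → Θ} (hθ : Measurable θ)
    (hθindep : IndepFun θ (fun ω n => S n ω) μ) :
    ∃ G : Set Ω, MeasurableSet G ∧ ENNReal.ofReal (1 - δ) ≤ μ G ∧
      ∀ ω ∈ G, T (θ ω, fun n => S n ω) < ENNReal.ofReal (c / δ) := by
  have hSm : Measurable fun ω n => S n ω := measurable_pi_lambda _ hS
  have hpair : Measurable fun ω => (θ ω, fun n => S n ω) := hθ.prodMk hSm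
  have hT : Measurable fun ω => T (θ ω, fun n => S n ω) := hTm.comp hpair
  have hlaw : μ.map (fun ω n => S n ω) = Measure.pi fun _ => 𝒟 := by
    rw [(iIndepFun_iff_map_fun_eq_pi_map fun i => (hS i).aemeasurable).1 hSindep]
    simp_rw [hSlaw]
  have : IsProbabilityMeasure (μ.map θ) := Measure.isProbabilityMeasure_map hθ.aemeasurable
  have hE : ∫⁻ ω, T (θ ω, fun n => S n ω) ∂μ ≤ ENNReal.ofReal c := by
    -- Independence makes the joint law a product, so the sample can be integrated out first, at a
    -- fixed parameter.
    have hjoint := (indepFun_iff_map_prod_eq_prod_map_map hθ.aemeasurable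
      hSm.aemeasurable).1 hθindep
    rw [hlaw] at hjoint
    have h1 := lintegral_map hTm hpair (μ := μ)
    rw [hjoint, lintegral_prod _ hTm.aemeasurable] at h1
    rw [← h1]
    exact (lintegral_mono hTc).trans (by simp)
  refine ⟨{ω | T (θ ω, fun n => S n ω) < ENNReal.ofReal (c / δ)},
    measurableSet_lt hT measurable_const, ?_, fun ω hω => hω⟩
  have hbad : μ {ω | ENNReal.ofReal (c / δ) ≤ T (θ ω, fun n => S n ω)} ≤
      ENNReal.ofReal δ := by
    have h1 := (mul_meas_ge_le_lintegral hT (ENNReal.ofReal (c / δ)) (μ := μ)).trans hE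
    have h2 : ENNReal.ofReal c = ENNReal.ofReal (c / δ) * ENNReal.ofReal δ := by
      rw [← ENNReal.ofReal_mul (by positivity), div_mul_cancel₀ _ hδ.ne']
    rw [h2] at h1
    refine (ENNReal.mul_le_mul_iff_right ?_ ENNReal.ofReal_ne_top).1 h1
    simp only [ne_eq, ENNReal.ofReal_eq_zero, not_le]
    positivity
  have hcompl : {ω | T (θ ω, fun n => S n ω) < ENNReal.ofReal (c / δ)} =
      {ω | ENNReal.ofReal (c / δ) ≤ T (θ ω, fun n => S n ω)}ᶜ := by
    ext ω; simp
  rw [hcompl, prob_compl_eq_one_sub (measurableSet_le measurable_const hT),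
    ENNReal.ofReal_sub _ hδ.le, ENNReal.ofReal_one]
  exact tsub_le_tsub_left hbad 1

/-! ### PAC-Bayes bound, uniform over posteriors -/

section PacBayes

variable {Θ Z : Type*} [MeasurableSpace Θ] [MeasurableSpace Z] {N : ℕ}
variable {ℓ : Θ → Z → ℝ} {𝒟 : Measure Z} [IsProbabilityMeasure 𝒟]

/-- The integrand of the mixture of the exponential moments of the risk gap. -/
def expGap (ℓ : Θ → Z → ℝ) (𝒟 : Measure Z) (s : Fin N → Z) (l : ℝ) (θ : Θ) : ℝ :=
  Real.exp (l * riskGap ℓ 𝒟 s θ - l ^ 2 / (8 * N))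

/-- The mixture, over the inverse temperature and the prior, of the exponential moments of the
risk gap of the perturbations of `θ`. -/
def expGapMixture [Add Θ] (ℓ : Θ → Z → ℝ) (𝒟 : Measure Z) (P : Measure Θ) (θ : Θ)
    (s : Fin N → Z) : ENNReal :=
  ∫⁻ p, ENNReal.ofReal (expGap ℓ 𝒟 s p.1 (θ + p.2))
    ∂((volume.restrict (Set.Ioc (0 : ℝ) (4 * N))).prod P)

lemma measurable_expGap (hℓ : Measurable (Function.uncurry ℓ)) :
    Measurable fun p : (Fin N → Z) × ℝ × Θ => expGap ℓ 𝒟 p.1 p.2.1 p.2.2 := by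
  unfold expGap
  have := (measurable_riskGap (N := N) (𝒟 := 𝒟) hℓ).comp
    (measurable_fst.prodMk measurable_snd.snd : Measurable fun p : (Fin N → Z) × ℝ × Θ =>
      (p.1, p.2.2))
  exact ((measurable_snd.fst.mul this).sub ((measurable_snd.fst.pow_const 2).div_const _)).exp

lemma lintegral_expGap_le_one (hN : 0 < N) (hℓ : Measurable (Function.uncurry ℓ))
    (hℓ01 : ∀ θ z, ℓ θ z ∈ Set.Icc (0 : ℝ) 1) (θ : Θ) (l : ℝ) :
    ∫⁻ s : Fin N → Z, ENNReal.ofReal (expGap ℓ 𝒟 s l θ) ∂(Measure.pi fun _ => 𝒟) ≤ 1 := by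
  have h1 := integrable_exp_riskGap (𝒟 := 𝒟) hN hℓ hℓ01 θ l
  have h2 : ∀ s : Fin N → Z, expGap ℓ 𝒟 s l θ =
      Real.exp (l * riskGap ℓ 𝒟 s θ) * Real.exp (-(l ^ 2 / (8 * N))) := fun s => by
    rw [expGap, ← Real.exp_add, sub_eq_add_neg]
  simp_rw [h2]
  rw [← ofReal_integral_eq_lintegral_ofReal (h1.mul_const _)
    (.of_forall fun s => by positivity), integral_mul_const]
  refine ENNReal.ofReal_le_one.2 ?_
  calc _ ≤ Real.exp (l ^ 2 / (8 * N)) * Real.exp (-(l ^ 2 / (8 * N))) := by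
        gcongr
        exact integral_exp_riskGap_le hN hℓ hℓ01 θ l
    _ = 1 := by rw [← Real.exp_add, add_neg_cancel, Real.exp_zero]

variable [Add Θ] [MeasurableAdd₂ Θ] {P : Measure Θ} [IsProbabilityMeasure P]

lemma measurable_ofReal_expGap_add (hℓ : Measurable (Function.uncurry ℓ)) :
    Measurable fun q : (Θ × (Fin N → Z)) × (ℝ × Θ) =>
      ENNReal.ofReal (expGap ℓ 𝒟 q.1.2 q.2.1 (q.1.1 + q.2.2)) := by
  have h1 : Measurable fun q : (Θ × (Fin N → Z)) × (ℝ × Θ) =>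
      (q.1.2, q.2.1, q.1.1 + q.2.2) :=
    measurable_fst.snd.prodMk (measurable_snd.fst.prodMk (measurable_fst.fst.add measurable_snd.snd))
  exact ((measurable_expGap hℓ).comp h1).ennreal_ofReal

lemma measurable_expGapMixture (hℓ : Measurable (Function.uncurry ℓ)) :
    Measurable fun q : Θ × (Fin N → Z) => expGapMixture ℓ 𝒟 P q.1 q.2 := by
  unfold expGapMixture
  exact (measurable_ofReal_expGap_add hℓ).lintegral_prod_right'

/-- By Tonelli the sample is integrated first and contributes at most 1 for every `l` and every
perturbation; what remains is the length 4N of the interval times the mass 1 of the prior. -/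
lemma lintegral_expGapMixture_le (hN : 0 < N) (hℓ : Measurable (Function.uncurry ℓ))
    (hℓ01 : ∀ θ z, ℓ θ z ∈ Set.Icc (0 : ℝ) 1) (θ : Θ) :
    ∫⁻ s : Fin N → Z, expGapMixture ℓ 𝒟 P θ s ∂(Measure.pi fun _ => 𝒟) ≤
      ENNReal.ofReal (4 * N) := by
  unfold expGapMixture
  rw [lintegral_lintegral_swap]
  · calc _ ≤ ∫⁻ _p : ℝ × Θ, 1 ∂((volume.restrict (Set.Ioc (0 : ℝ) (4 * N))).prod P) :=
          lintegral_mono fun p => lintegral_expGap_le_one hN hℓ hℓ01 _ _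
      _ = ENNReal.ofReal (4 * N) := by
          rw [lintegral_one, ← Set.univ_prod_univ, Measure.prod_prod]
          simp
  · have h1 : Measurable fun q : (Fin N → Z) × (ℝ × Θ) => ((θ, q.1), q.2) :=
      (measurable_const.prodMk measurable_fst).prodMk measurable_snd
    exact ((measurable_ofReal_expGap_add hℓ).comp h1).aemeasurable

/-- The deterministic half of the argument: the sample is fixed, so `Q` may depend on it in any way.
-/
lemma integral_riskGap_le_of_expGapMixture_lt (hN : 0 < N) (hℓ : Measurable (Function.uncurry ℓ))
    (hℓ01 : ∀ θ z, ℓ θ z ∈ Set.Icc (0 : ℝ) 1) {δ : ℝ} (hδ : 0 < δ) {θ : Θ} {s : Fin N → Z}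
    (h : expGapMixture ℓ 𝒟 P θ s < ENNReal.ofReal (4 * N / δ)) {Q : Measure Θ}
    [IsProbabilityMeasure Q] (hKL : klDiv Q P ≠ ⊤) :
    ∫ v, riskGap ℓ 𝒟 s (θ + v) ∂Q ≤
      Real.sqrt (((klDiv Q P).toReal + Real.log (2 * Real.sqrt N / δ)) / (2 * N)) := by
  have hN' : (0 : ℝ) < N := by exact_mod_cast hN
  have hN1 : (1 : ℝ) ≤ N := by exact_mod_cast hN
  set x := ∫ v, riskGap ℓ 𝒟 s (θ + v) ∂Q with hx
  set k := (klDiv Q P).toReal with hk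
  rcases le_or_gt x 0 with hx0 | hx0
  · exact hx0.trans (Real.sqrt_nonneg _)
  have hgm : Measurable fun v => riskGap ℓ 𝒟 s (θ + v) :=
    (measurable_riskGap hℓ).comp (measurable_const.prodMk (measurable_const_add θ))
  have hg1 : ∀ v, |riskGap ℓ 𝒟 s (θ + v)| ≤ 1 := fun v => abs_riskGap_le_one hN hℓ hℓ01 s _
  have hx1 : x ≤ 1 := by
    calc x ≤ ∫ _, (1 : ℝ) ∂Q := integral_mono
          (.of_bound hgm.aestronglyMeasurable 1 (.of_forall hg1)) (integrable_const _)
          fun v => (le_abs_self _).trans (hg1 v)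
      _ = 1 := by simp
  -- Change of measure applied to `l` times the gap, one inequality for each `l`.
  have hDV : ∀ l : ℝ, ENNReal.ofReal (Real.exp (l * x - l ^ 2 / (8 * N))) ≤
      ENNReal.ofReal (Real.exp k) * ∫⁻ v, ENNReal.ofReal (expGap ℓ 𝒟 s l (θ + v)) ∂P := by
    intro l
    have hgl : ∀ v, |l * riskGap ℓ 𝒟 s (θ + v)| ≤ |l| := fun v => by
      rw [abs_mul]
      exact mul_le_of_le_one_right (abs_nonneg _) (hg1 v)
    have h1 := exp_integral_le_exp_klDiv_mul hKL (hgm.const_mul l) hgl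
    rw [integral_const_mul] at h1
    have hint : Integrable (fun v => Real.exp (l * riskGap ℓ 𝒟 s (θ + v))) P := by
      refine .of_bound (hgm.const_mul l).exp.aestronglyMeasurable (Real.exp |l|)
        (.of_forall fun v => ?_)
      rw [Real.norm_eq_abs, Real.abs_exp]
      exact Real.exp_le_exp.2 ((le_abs_self _).trans (hgl v))
    have h2 : ∀ v, expGap ℓ 𝒟 s l (θ + v) =
        Real.exp (l * riskGap ℓ 𝒟 s (θ + v)) * Real.exp (-(l ^ 2 / (8 * N))) := fun v => by
      rw [expGap, ← Real.exp_add, sub_eq_add_neg]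
    simp_rw [h2]
    rw [← ofReal_integral_eq_lintegral_ofReal (hint.mul_const _)
      (.of_forall fun v => by positivity), integral_mul_const,
      ← ENNReal.ofReal_mul (Real.exp_pos _).le, ← mul_assoc]
    refine ENNReal.ofReal_le_ofReal ?_
    rw [sub_eq_add_neg, Real.exp_add]
    gcongr
  have hcont : Continuous fun l : ℝ => Real.exp (l * x - l ^ 2 / (8 * N)) := by fun_prop
  have hA := exp_two_mul_sq_le_integral hN1 hx0.le hx1
  rw [intervalIntegral.integral_of_le (by positivity)] at hA
  have hB : ENNReal.ofReal (∫ l in Set.Ioc (0 : ℝ) (4 * N),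
      Real.exp (l * x - l ^ 2 / (8 * N))) < ENNReal.ofReal (Real.exp k * (4 * N / δ)) := by
    rw [ofReal_integral_eq_lintegral_ofReal
      ((hcont.integrableOn_Icc).mono_set Set.Ioc_subset_Icc_self)
      (.of_forall fun l => (Real.exp_pos _).le)]
    calc _ ≤ ∫⁻ l in Set.Ioc (0 : ℝ) (4 * N), ENNReal.ofReal (Real.exp k) *
          ∫⁻ v, ENNReal.ofReal (expGap ℓ 𝒟 s l (θ + v)) ∂P := lintegral_mono hDV
      _ = ENNReal.ofReal (Real.exp k) * expGapMixture ℓ 𝒟 P θ s := by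
          have hm : Measurable fun p : ℝ × Θ =>
              ENNReal.ofReal (expGap ℓ 𝒟 s p.1 (θ + p.2)) :=
            (measurable_ofReal_expGap_add hℓ).comp (measurable_const (a := (θ, s)) |>.prodMk
              measurable_id)
          rw [lintegral_const_mul _ hm.lintegral_prod_right', expGapMixture,
            lintegral_prod _ hm.aemeasurable]
      _ < ENNReal.ofReal (Real.exp k) * ENNReal.ofReal (4 * N / δ) := by
          refine (ENNReal.mul_lt_mul_iff_right ?_ ENNReal.ofReal_ne_top).2 h
          simpa using Real.exp_pos k
      _ = _ := (ENNReal.ofReal_mul (Real.exp_pos _).le).symm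
  have hC := hA.trans (ENNReal.ofReal_lt_ofReal_iff_of_nonneg (le_trans (by positivity) hA)
    |>.1 hB).le
  have hs : (0 : ℝ) < Real.sqrt N := Real.sqrt_pos.2 hN'
  have hD : Real.exp (2 * N * x ^ 2) ≤ Real.exp (k + Real.log (2 * Real.sqrt N / δ)) := by
    rw [Real.exp_add, Real.exp_log (by positivity)]
    -- Since 4N = (2√N)², one factor 2√N cancels against the Gaussian integral and the other stays
    -- inside the logarithm.
    have h4 : Real.exp k * (4 * N / δ) =
        2 * Real.sqrt N * (Real.exp k * (2 * Real.sqrt N / δ)) := by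
      have := Real.mul_self_sqrt hN'.le
      linear_combination (-4 * Real.exp k / δ) * this
    rw [h4] at hC
    exact le_of_mul_le_mul_left hC (by positivity)
  rw [Real.exp_le_exp] at hD
  refine Real.le_sqrt_of_sq_le ?_
  rw [le_div_iff₀ (by positivity)]
  linarith

/-- The PAC-Bayes bound, uniformly over the posteriors, for perturbations of a random parameter
that is independent of the sample. -/
theorem exists_pacBayes_event (hN : 0 < N) (hℓ : Measurable (Function.uncurry ℓ))
    (hℓ01 : ∀ θ z, ℓ θ z ∈ Set.Icc (0 : ℝ) 1) {δ : ℝ} (hδ : 0 < δ)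
    (P : Measure Θ) [IsProbabilityMeasure P]
    {Ω : Type*} [MeasurableSpace Ω] (μ : Measure Ω) [IsProbabilityMeasure μ]
    {S : Fin N → Ω → Z} (hS : ∀ i, Measurable (S i)) (hSindep : iIndepFun S μ)
    (hSlaw : ∀ i, μ.map (S i) = 𝒟) {θ : Ω → Θ} (hθ : Measurable θ)
    (hθindep : IndepFun θ (fun ω n => S n ω) μ) :
    ∃ G : Set Ω, MeasurableSet G ∧ ENNReal.ofReal (1 - δ) ≤ μ G ∧
      ∀ ω ∈ G, ∀ (Q : Measure Θ) [IsProbabilityMeasure Q], klDiv Q P ≠ ⊤ →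
        ∫ v, riskGap ℓ 𝒟 (S · ω) (θ ω + v) ∂Q ≤
          Real.sqrt (((klDiv Q P).toReal + Real.log (2 * Real.sqrt N / δ)) / (2 * N)) := by
  have hN' : (0 : ℝ) < N := by exact_mod_cast hN
  obtain ⟨G, hG, hGμ, hGT⟩ := exists_event_lt_of_lintegral_le
    (measurable_expGapMixture (N := N) (𝒟 := 𝒟) (P := P) hℓ) (by positivity : (0 : ℝ) < 4 * N) hδ
    (lintegral_expGapMixture_le hN hℓ hℓ01) μ hS hSindep hSlaw hθ hθindep
  exact ⟨G, hG, hGμ, fun ω hω Q _ hKL =>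
    integral_riskGap_le_of_expGapMixture_lt hN hℓ hℓ01 hδ (hGT ω hω) hKL⟩

end PacBayes

/-! ### KL divergence between Gaussians -/

lemma klDiv_of_eq_withDensity_exp {E : Type*} [MeasurableSpace E] {Q P : Measure E}
    [IsProbabilityMeasure Q] [IsProbabilityMeasure P] {g : E → ℝ} (hg : Measurable g)
    (hQ : Q = P.withDensity fun x => ENNReal.ofReal (Real.exp (g x))) (hgQ : Integrable g Q) :
    klDiv Q P = ENNReal.ofReal (∫ x, g x ∂Q) := by
  have hac : Q ≪ P := hQ ▸ withDensity_absolutelyContinuous _ _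
  have hllr : llr Q P =ᵐ[Q] g := by
    apply hac.ae_le
    have h1 : Q.rnDeriv P =ᵐ[P] fun x => ENNReal.ofReal (Real.exp (g x)) := by
      rw [hQ]
      exact Measure.rnDeriv_withDensity P hg.exp.ennreal_ofReal
    filter_upwards [h1] with x hx
    rw [llr, hx, ENNReal.toReal_ofReal (Real.exp_pos _).le, Real.log_exp]
  rw [klDiv_of_ac_of_integrable hac (hgQ.congr hllr.symm), integral_congr_ae hllr]
  simp

/-- Data processing, applied to `e` and to its inverse. -/
lemma klDiv_map_measurableEquiv {E F : Type*} [MeasurableSpace E] [MeasurableSpace F]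
    (Q P : Measure E) [IsFiniteMeasure Q] [IsFiniteMeasure P] (e : E ≃ᵐ F) :
    klDiv (Q.map e) (P.map e) = klDiv Q P := by
  refine le_antisymm (klDiv_map_le _ _ e.measurable) ?_
  have h := klDiv_map_le (Q.map e) (P.map e) e.symm.measurable
  simpa using h

/-- The logarithm of the density of `N(m, v)` with respect to `N(0, w)`. -/
def gaussianLogRatio (m v w x : ℝ) : ℝ :=
  -(Real.log (v / w) / 2) - (x - m) ^ 2 / (2 * v) + x ^ 2 / (2 * w)

lemma measurable_gaussianLogRatio (m v w : ℝ) : Measurable (gaussianLogRatio m v w) := by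
  unfold gaussianLogRatio; fun_prop

lemma gaussianPDFReal_eq_mul_exp {m : ℝ} {v w : NNReal} (hv : v ≠ 0) (hw : w ≠ 0) (x : ℝ) :
    gaussianPDFReal m v x = gaussianPDFReal 0 w x * Real.exp (gaussianLogRatio m v w x) := by
  have hv' : (0 : ℝ) < v := by positivity
  have hw' : (0 : ℝ) < w := by positivity
  have hr : (0 : ℝ) < (v : ℝ) / w := by positivity
  have h1 : Real.exp (-(Real.log ((v : ℝ) / w) / 2)) = (Real.sqrt ((v : ℝ) / w))⁻¹ := by
    rw [← Real.log_sqrt hr.le, Real.exp_neg, Real.exp_log (Real.sqrt_pos.2 hr)]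
  have h2 : gaussianLogRatio m v w x = -(Real.log ((v : ℝ) / w) / 2) +
      (-(x - m) ^ 2 / (2 * v) + x ^ 2 / (2 * w)) := by
    unfold gaussianLogRatio; ring
  rw [h2, Real.exp_add, h1, gaussianPDFReal, gaussianPDFReal, Real.sqrt_div hv'.le,
    Real.sqrt_mul (by positivity) (v : ℝ), Real.sqrt_mul (by positivity) (w : ℝ)]
  have h3 : Real.exp (-(x - m) ^ 2 / (2 * v)) = Real.exp (-(x - 0) ^ 2 / (2 * w)) *
      Real.exp (-(x - m) ^ 2 / (2 * v) + x ^ 2 / (2 * w)) := by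
    rw [← Real.exp_add]; congr 1; ring
  rw [h3]
  have := (Real.sqrt_pos.2 hv').ne'
  have := (Real.sqrt_pos.2 hw').ne'
  field_simp

lemma gaussianReal_eq_withDensity {m : ℝ} {v w : NNReal} (hv : v ≠ 0) (hw : w ≠ 0) :
    gaussianReal m v = (gaussianReal 0 w).withDensity
      fun x => ENNReal.ofReal (Real.exp (gaussianLogRatio m v w x)) := by
  rw [gaussianReal_of_var_ne_zero _ hv, gaussianReal_of_var_ne_zero _ hw,
    ← withDensity_mul _ (measurable_gaussianPDF _ _)
      (measurable_gaussianLogRatio m v w).exp.ennreal_ofReal]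
  congr 1
  ext x
  rw [Pi.mul_apply, gaussianPDF, gaussianPDF, ← ENNReal.ofReal_mul (gaussianPDFReal_nonneg _ _ _),
    gaussianPDFReal_eq_mul_exp hv hw]

lemma integrable_sub_sq_gaussianReal (m c : ℝ) (v : NNReal) :
    Integrable (fun x => (x - c) ^ 2) (gaussianReal m v) :=
  ((memLp_id_gaussianReal (μ := m) (v := v) 2).sub (memLp_const c)).integrable_sq

lemma integral_sq_gaussianReal (m : ℝ) (v : NNReal) :
    ∫ x, x ^ 2 ∂(gaussianReal m v) = v + m ^ 2 := by
  have h := variance_eq_sub (memLp_id_gaussianReal (μ := m) (v := v) 2)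
  rw [variance_id_gaussianReal] at h
  simp at h
  linarith

lemma integral_sub_sq_gaussianReal (m : ℝ) (v : NNReal) :
    ∫ x, (x - m) ^ 2 ∂(gaussianReal m v) = v := by
  have h := variance_eq_integral (μ := gaussianReal m v) (X := id) aemeasurable_id
  rw [variance_id_gaussianReal] at h
  simpa using h.symm

lemma integrable_gaussianLogRatio (m : ℝ) (v w : NNReal) :
    Integrable (gaussianLogRatio m v w) (gaussianReal m v) := by
  have h1 := (integrable_sub_sq_gaussianReal m m v).div_const (2 * (v : ℝ))
  have h2 := (integrable_sub_sq_gaussianReal m 0 v).div_const (2 * (w : ℝ))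
  simp only [sub_zero] at h2
  exact ((integrable_const _).sub h1).add h2

lemma integral_gaussianLogRatio {m : ℝ} {v w : NNReal} (hv : v ≠ 0) (hw : w ≠ 0) :
    ∫ x, gaussianLogRatio m v w x ∂(gaussianReal m v) = m ^ 2 / (2 * w) + h (v / w) / 2 := by
  have hv' : (v : ℝ) ≠ 0 := by exact_mod_cast hv
  have hw' : (w : ℝ) ≠ 0 := by exact_mod_cast hw
  have h1 := (integrable_sub_sq_gaussianReal m m v).div_const (2 * (v : ℝ))
  have h2 := (integrable_sub_sq_gaussianReal m 0 v).div_const (2 * (w : ℝ))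
  simp only [sub_zero] at h2
  have h3 : Integrable (fun x => -(Real.log ((v : ℝ) / w) / 2) - (x - m) ^ 2 / (2 * v))
      (gaussianReal m v) := (integrable_const _).sub h1
  unfold gaussianLogRatio
  rw [integral_add h3 h2, integral_sub (integrable_const _) h1,
    integral_div, integral_div, integral_sq_gaussianReal, integral_sub_sq_gaussianReal]
  simp [h]
  field_simp
  ring

lemma pi_gaussianReal_eq_withDensity {ι : Type*} [Fintype ι] {m : ι → ℝ} {v : ι → NNReal}
    {w : NNReal} (hv : ∀ i, v i ≠ 0) (hw : w ≠ 0) :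
    Measure.pi (fun i => gaussianReal (m i) (v i)) =
      (Measure.pi fun _ : ι => gaussianReal 0 w).withDensity
        fun x => ENNReal.ofReal (Real.exp (∑ i, gaussianLogRatio (m i) (v i) w (x i))) := by
  refine Measure.pi_eq fun s hs => ?_
  -- Integrability is read off from the one-dimensional identity: the density has the total mass of
  -- a probability measure.
  have hint : ∀ i, Integrable (fun x => Real.exp (gaussianLogRatio (m i) (v i) w x))
      (gaussianReal 0 w) := fun i => by
    refine (lintegral_ofReal_ne_top_iff_integrable
      (measurable_gaussianLogRatio _ _ _).exp.aestronglyMeasurable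
      (.of_forall fun x => (Real.exp_pos _).le)).1 ?_
    rw [← setLIntegral_univ, ← withDensity_apply _ MeasurableSet.univ,
      ← gaussianReal_eq_withDensity (hv i) hw]
    simp
  rw [withDensity_apply _ (MeasurableSet.univ_pi hs), Measure.restrict_pi_pi]
  simp_rw [Real.exp_sum]
  rw [← ofReal_integral_eq_lintegral_ofReal
    (Integrable.fintype_prod fun i => (hint i).integrableOn)
    (.of_forall fun x => Finset.prod_nonneg fun i _ => (Real.exp_pos _).le),
    integral_fintype_prod_eq_prod
      (f := fun i x => Real.exp (gaussianLogRatio (m i) (v i) w x)),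
    ENNReal.ofReal_prod_of_nonneg fun i _ => integral_nonneg fun x => (Real.exp_pos _).le]
  refine Finset.prod_congr rfl fun i _ => ?_
  rw [ofReal_integral_eq_lintegral_ofReal (hint i).integrableOn
    (.of_forall fun x => (Real.exp_pos _).le), ← withDensity_apply _ (hs i),
    ← gaussianReal_eq_withDensity (hv i) hw]

lemma measurable_sum_gaussianLogRatio {ι : Type*} [Fintype ι] (m v : ι → ℝ) (w : ℝ) :
    Measurable fun x : ι → ℝ => ∑ i, gaussianLogRatio (m i) (v i) w (x i) := by
  unfold gaussianLogRatio
  fun_prop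

lemma integrable_gaussianLogRatio_eval {ι : Type*} [Fintype ι] (m : ι → ℝ) (v : ι → NNReal)
    (w : NNReal) (i : ι) : Integrable (fun x : ι → ℝ => gaussianLogRatio (m i) (v i) w (x i))
      (Measure.pi fun i => gaussianReal (m i) (v i)) :=
  integrable_comp_eval (μ := fun i => gaussianReal (m i) (v i))
    (integrable_gaussianLogRatio (m i) (v i) w)

lemma integral_gaussianLogRatio_eval {ι : Type*} [Fintype ι] {m : ι → ℝ} {v : ι → NNReal}
    {w : NNReal} (hv : ∀ i, v i ≠ 0) (hw : w ≠ 0) (i : ι) :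
    ∫ x : ι → ℝ, gaussianLogRatio (m i) (v i) w (x i)
      ∂(Measure.pi fun i => gaussianReal (m i) (v i)) =
        m i ^ 2 / (2 * w) + h (v i / w) / 2 := by
  rw [← integral_gaussianLogRatio (hv i) hw]
  exact integral_comp_eval (μ := fun i => gaussianReal (m i) (v i))
    (measurable_gaussianLogRatio (m i) (v i) w).aestronglyMeasurable

lemma klDiv_pi_gaussianReal {ι : Type*} [Fintype ι] {m : ι → ℝ} {v : ι → NNReal}
    {w : NNReal} (hv : ∀ i, v i ≠ 0) (hw : w ≠ 0) :
    klDiv (Measure.pi fun i => gaussianReal (m i) (v i))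
      (Measure.pi fun _ : ι => gaussianReal 0 w) =
      ENNReal.ofReal (∑ i, (m i ^ 2 / (2 * w) + h (v i / w) / 2)) := by
  rw [klDiv_of_eq_withDensity_exp (measurable_sum_gaussianLogRatio m (fun i => v i) w)
      (pi_gaussianReal_eq_withDensity hv hw)
      (integrable_finsetSum _ fun i _ => integrable_gaussianLogRatio_eval m v w i),
    integral_finsetSum _ fun i _ => integrable_gaussianLogRatio_eval m v w i]
  simp_rw [integral_gaussianLogRatio_eval hv hw]

/-- The measurable equivalence given by the coordinates in an orthonormal basis. -/
def basisCoordEquiv {P : ℕ} (b : OrthonormalBasis (Fin P) ℝ (Vec P)) : (Fin P → ℝ) ≃ᵐ Vec P :=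
  (MeasurableEquiv.toLp 2 (Fin P → ℝ)).trans
    b.repr.symm.toHomeomorph.toMeasurableEquiv

lemma basisCoordEquiv_apply {P : ℕ} (b : OrthonormalBasis (Fin P) ℝ (Vec P)) (x : Fin P → ℝ) :
    basisCoordEquiv b x = b.repr.symm (WithLp.toLp 2 x) := rfl

/-- Both characteristic functions agree, since the quadratic form of `S` is diagonal in an
eigenbasis. Leaving `b` free lets posterior and prior be written in the same coordinates. -/
lemma multivariateGaussian_eq_map_pi {P : ℕ} {S : Matrix (Fin P) (Fin P) ℝ} (hS : S.PosSemidef)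
    (b : OrthonormalBasis (Fin P) ℝ (Vec P)) (m : Vec P) {v : Fin P → NNReal}
    (hv : ∀ i, S.mulVec (b i).ofLp = (v i : ℝ) • (b i).ofLp) :
    multivariateGaussian m S =
      (Measure.pi fun i => gaussianReal (b.repr m i) (v i)).map (basisCoordEquiv b) := by
  have : IsProbabilityMeasure ((Measure.pi fun i => gaussianReal (b.repr m i) (v i)).map
      (basisCoordEquiv b)) := Measure.isProbabilityMeasure_map (by fun_prop)
  refine Measure.ext_of_charFun ?_
  ext t
  have h1 : charFun ((Measure.pi fun i => gaussianReal (b.repr m i) (v i)).map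
      (basisCoordEquiv b)) t = charFun ((Measure.pi fun i => gaussianReal (b.repr m i) (v i)).map
      (WithLp.toLp 2)) (b.repr t) := by
    rw [charFun_apply, charFun_apply, integral_map (by fun_prop) (by fun_prop),
      integral_map (by fun_prop) (by fun_prop)]
    simp_rw [basisCoordEquiv_apply]
    congr 1
    ext x
    rw [← b.repr.inner_map_map (b.repr.symm (WithLp.toLp 2 x)) t,
      LinearIsometryEquiv.apply_symm_apply]
  rw [h1, charFun_pi, charFun_multivariateGaussian hS]
  simp_rw [charFun_gaussianReal]
  rw [← Complex.exp_sum]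
  have h2 : inner ℝ t m = ∑ i, b.repr t i * b.repr m i := by
    rw [← b.repr.inner_map_map t m, PiLp.inner_apply]
    simp [mul_comm]
  have h3 : dotProduct t.ofLp (S.mulVec t.ofLp) = ∑ i, v i * b.repr t i ^ 2 := by
    have ht : S.mulVec t.ofLp = ∑ i, (b.repr t i * v i) • (b i).ofLp := by
      conv_lhs => rw [← b.sum_repr t]
      rw [WithLp.ofLp_sum, Matrix.mulVec_sum]
      refine Finset.sum_congr rfl fun i _ => ?_
      rw [WithLp.ofLp_smul, Matrix.mulVec_smul, hv, smul_smul]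
    rw [ht, dotProduct_sum]
    refine Finset.sum_congr rfl fun i _ => ?_
    have h4 : dotProduct t.ofLp (b i).ofLp = b.repr t i := by
      rw [b.repr_apply_apply, PiLp.inner_apply]
      simp [dotProduct]
    rw [dotProduct_smul, h4, smul_eq_mul]
    ring
  rw [h2, h3]
  congr 1
  push_cast
  rw [Finset.sum_sub_distrib, Finset.sum_mul, Finset.sum_div]

/-! ### The posterior and its divergence from the prior -/

section Posterior

variable {P : ℕ} {κ : Type*} [Fintype κ] {α σ : ℝ}

lemma posDef_one_add_smul_transpose_mul (α σ : ℝ) (J : Matrix κ (Fin P) ℝ) :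
    (1 + (α ^ 2 / σ ^ 2) • (J.transpose * J)).PosDef := by
  refine Matrix.PosDef.one.add_posSemidef (Matrix.PosSemidef.smul ?_ (by positivity))
  simpa using Matrix.posSemidef_conjTranspose_mul_self J

lemma sharpnessMatrix_posDef (α σ : ℝ) (J : Matrix κ (Fin P) ℝ) :
    (sharpnessMatrix α σ J).PosDef :=
  (posDef_one_add_smul_transpose_mul α σ J).inv

lemma beta_pos (α σ : ℝ) (J : Matrix κ (Fin P) ℝ) (i : Fin P) : 0 < beta α σ J i :=
  (sharpnessMatrix_posDef α σ J).eigenvalues_pos i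

lemma posteriorCov_eq_smul (hα : 0 < α) (J : Matrix κ (Fin P) ℝ) :
    posteriorCov α σ J = α ^ 2 • sharpnessMatrix α σ J := by
  have h1 : (1 / α ^ 2) • (1 : Matrix (Fin P) (Fin P) ℝ) + (1 / σ ^ 2) • (J.transpose * J) =
      (α ^ 2)⁻¹ • (1 + (α ^ 2 / σ ^ 2) • (J.transpose * J)) := by
    rw [smul_add, smul_smul, one_div]
    congr 2
    field_simp
  have hdet := (posDef_one_add_smul_transpose_mul α σ J).det_pos.ne'.isUnit
  rw [posteriorCov, sharpnessMatrix, h1]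
  refine Matrix.inv_eq_left_inv ?_
  rw [Matrix.smul_mul, Matrix.mul_smul, smul_smul, mul_inv_cancel₀ (by positivity), one_smul,
    Matrix.nonsing_inv_mul _ hdet]

lemma h_nonneg {x : ℝ} (hx : 0 < x) : 0 ≤ h x := by
  have := Real.log_le_sub_one_of_pos hx
  rw [h]
  linarith

/-- Every orthonormal basis diagonalizes the isotropic prior, so that of `sharpnessMatrix` serves
both measures. The variances are α²β'_i and α², with ratio β'_i, and the squared norm of the mean
does not depend on the basis. -/
lemma klDiv_multivariateGaussian_prior (hα : 0 < α) (J : Matrix κ (Fin P) ℝ) (m : Fin P → ℝ) :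
    klDiv (multivariateGaussian (WithLp.toLp 2 m) (posteriorCov α σ J)) (prior P α) =
      ENNReal.ofReal (dotProduct m m / (2 * α ^ 2) + ∑ i, h (beta α σ J i) / 2) := by
  set b := (sharpnessMatrix_isHermitian α σ J).eigenvectorBasis with hb
  let w : NNReal := ⟨α ^ 2, by positivity⟩
  let v : Fin P → NNReal := fun i => ⟨α ^ 2 * beta α σ J i,
    mul_nonneg (by positivity) (beta_pos α σ J i).le⟩
  have hw : w ≠ 0 := by
    intro h0
    have : α ^ 2 = 0 := congrArg NNReal.toReal h0
    exact (by positivity : α ^ 2 ≠ 0) this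
  have hv : ∀ i, v i ≠ 0 := by
    intro i h0
    have : α ^ 2 * beta α σ J i = 0 := congrArg NNReal.toReal h0
    exact (mul_pos (by positivity) (beta_pos α σ J i)).ne' this
  have hQ := multivariateGaussian_eq_map_pi (S := posteriorCov α σ J)
    (by rw [posteriorCov_eq_smul hα]
        exact (sharpnessMatrix_posDef α σ J).posSemidef.smul (by positivity)) b
    (WithLp.toLp 2 m) (v := v) fun i => by
      rw [posteriorCov_eq_smul hα, Matrix.smul_mulVec, Matrix.IsHermitian.mulVec_eigenvectorBasis,
        smul_smul]
      rfl
  have hP := multivariateGaussian_eq_map_pi (P := P) (S := α ^ 2 • 1)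
    (Matrix.PosSemidef.one.smul (by positivity)) b 0 (v := fun _ => w) fun i => by
      rw [Matrix.smul_mulVec, Matrix.one_mulVec]
      rfl
  simp only [map_zero, PiLp.zero_apply] at hP
  rw [prior, hQ, hP, klDiv_map_measurableEquiv, klDiv_pi_gaussianReal hv hw]
  congr 1
  rw [Finset.sum_add_distrib, ← Finset.sum_div]
  have h1 : ∑ i, b.repr (WithLp.toLp 2 m) i ^ 2 = dotProduct m m := by
    rw [← EuclideanSpace.real_norm_sq_eq, LinearIsometryEquiv.norm_map,
      EuclideanSpace.real_norm_sq_eq]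
    simp [dotProduct, sq]
  rw [h1]
  congr 1
  refine Finset.sum_congr rfl fun i _ => ?_
  have h2 : ((v i : ℝ) / (w : ℝ)) = beta α σ J i :=
    mul_div_cancel_left₀ _ (by positivity : α ^ 2 ≠ 0)
  rw [h2]

end Posterior

/-! ### The β' and the spectrum of the NTK -/

section Spectrum

open Polynomial in
lemma charpoly_eq_prod_of_eigenbasis {P : ℕ} {A : Matrix (Fin P) (Fin P) ℝ}
    (b : OrthonormalBasis (Fin P) ℝ (Vec P)) {lam : Fin P → ℝ}
    (hA : ∀ i, A.mulVec (b i).ofLp = lam i • (b i).ofLp) :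
    A.charpoly = ∏ i, (X - C (lam i)) := by
  let b' : Module.Basis (Fin P) ℝ (Fin P → ℝ) := b.toBasis.map (WithLp.linearEquiv 2 ℝ (Fin P → ℝ))
  have hb' : ∀ i, b' i = (b i).ofLp := fun i => by simp [b']
  have h1 : LinearMap.toMatrix b' b' (Matrix.toLin' A) = Matrix.diagonal lam := by
    ext i j
    rw [LinearMap.toMatrix_apply, Matrix.toLin'_apply, hb', hA, ← hb', map_smul,
      Module.Basis.repr_self, Finsupp.smul_apply, Finsupp.single_apply, Matrix.diagonal_apply]
    rcases eq_or_ne i j with rfl | hij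
    · simp
    · simp [hij, hij.symm]
  have h2 := LinearMap.charpoly_toMatrix (Matrix.toLin' A) b'
  have h3 := LinearMap.charpoly_toMatrix (Matrix.toLin' A) (Pi.basisFun ℝ (Fin P))
  rw [LinearMap.toMatrix_eq_toMatrix', LinearMap.toMatrix'_toLin'] at h3
  rw [h3, ← h2, h1, Matrix.charpoly_diagonal]

open Polynomial in
lemma rootMultiplicity_prod_X_sub_C {ι : Type*} [Fintype ι] (lam : ι → ℝ) (x : ℝ) :
    (∏ i, (X - C (lam i))).rootMultiplicity x = {i | lam i = x}.ncard := by
  classical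
  rw [← count_roots, roots_prod _ _ (Finset.prod_ne_zero_iff.2 fun i _ => X_sub_C_ne_zero _)]
  simp only [roots_X_sub_C, Multiset.bind_singleton, Multiset.count_map]
  rw [Set.ncard_eq_toFinset_card', Set.toFinset_ofPred]
  simp only [eq_comm (a := x)]
  rfl

open Polynomial in
-- The two characteristic polynomials agree up to powers of X, which do not vanish at x ≠ 0.
lemma rootMultiplicity_charpoly_mul_comm {m n : Type*} [Fintype m] [Fintype n] [DecidableEq m]
    [DecidableEq n] (A : Matrix m n ℝ) (B : Matrix n m ℝ) {x : ℝ} (hx : x ≠ 0) :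
    (A * B).charpoly.rootMultiplicity x = (B * A).charpoly.rootMultiplicity x := by
  have key : ∀ (k : ℕ) (p : ℝ[X]), p ≠ 0 →
      (X ^ k * p).rootMultiplicity x = p.rootMultiplicity x := fun k p hp => by
    rw [rootMultiplicity_mul (mul_ne_zero (pow_ne_zero _ X_ne_zero) hp),
      rootMultiplicity_eq_zero (by simp [hx]), zero_add]
  rw [← key (Fintype.card n) _ (Matrix.charpoly_monic _).ne_zero, Matrix.charpoly_mul_comm' A B,
    key _ _ (Matrix.charpoly_monic _).ne_zero]

variable {P : ℕ} {κ : Type*} [Fintype κ] {α σ : ℝ}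

lemma transpose_mul_self_mulVec_eigenvectorBasis (hα : 0 < α) (hσ : 0 < σ)
    (J : Matrix κ (Fin P) ℝ) (i : Fin P) :
    (J.transpose * J).mulVec ((sharpnessMatrix_isHermitian α σ J).eigenvectorBasis i).ofLp =
      (((beta α σ J i)⁻¹ - 1) / (α ^ 2 / σ ^ 2)) •
        ((sharpnessMatrix_isHermitian α σ J).eigenvectorBasis i).ofLp := by
  set u := ((sharpnessMatrix_isHermitian α σ J).eigenvectorBasis i).ofLp with hu
  have hc : α ^ 2 / σ ^ 2 ≠ 0 := by positivity
  have hb := (beta_pos α σ J i).ne'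
  have h1 : (sharpnessMatrix α σ J).mulVec u = beta α σ J i • u :=
    (sharpnessMatrix_isHermitian α σ J).mulVec_eigenvectorBasis i
  have hdet := (posDef_one_add_smul_transpose_mul α σ J).det_pos.ne'.isUnit
  have h2 := congrArg (1 + (α ^ 2 / σ ^ 2) • (J.transpose * J)).mulVec h1
  rw [sharpnessMatrix, Matrix.mulVec_mulVec, Matrix.mul_nonsing_inv _ hdet, Matrix.one_mulVec,
    Matrix.mulVec_smul, Matrix.add_mulVec, Matrix.one_mulVec, Matrix.smul_mulVec] at h2
  ext j
  have h3 := congrFun h2 j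
  simp only [Pi.smul_apply, Pi.add_apply, smul_eq_mul] at h3 ⊢
  field_simp at h3 ⊢
  linear_combination -h3

/-- The witness solves β = σ²/(σ² + α²λ) for λ. These numbers are eigenvalues of JᵀJ on the
eigenbasis of `sharpnessMatrix`, so their multiplicities can be compared with those of JJᵀ as root
multiplicities. -/
lemma exists_ntk_eigenvalues [DecidableEq κ] (hα : 0 < α) (hσ : 0 < σ)
    (J : Matrix κ (Fin P) ℝ) :
    ∃ lam : Fin P → ℝ,
      (∀ x : ℝ, x ≠ 0 → {i | lam i = x}.ncard = {j | ntkEigenvalues J j = x}.ncard) ∧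
      ∀ i, beta α σ J i = σ ^ 2 / (σ ^ 2 + α ^ 2 * lam i) := by
  refine ⟨fun i => ((beta α σ J i)⁻¹ - 1) / (α ^ 2 / σ ^ 2), fun x hx => ?_, fun i => ?_⟩
  · have h1 := charpoly_eq_prod_of_eigenbasis _
      (transpose_mul_self_mulVec_eigenvectorBasis hα hσ J)
    have h2 := (ntk_isHermitian J).charpoly_eq
    rw [← rootMultiplicity_prod_X_sub_C, ← h1, rootMultiplicity_charpoly_mul_comm _ _ hx,
      ← rootMultiplicity_prod_X_sub_C]
    exact congrArg (Polynomial.rootMultiplicity x) h2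
  · have hb := (beta_pos α σ J i).ne'
    have h1 : σ ^ 2 + α ^ 2 * (((beta α σ J i)⁻¹ - 1) / (α ^ 2 / σ ^ 2)) =
        σ ^ 2 * (beta α σ J i)⁻¹ := by
      field_simp
      ring
    rw [h1]
    field_simp

/-- Trace and determinant give the sharpness term without identifying or ordering individual
eigenvalues. -/
lemma sum_h_beta (J : Matrix κ (Fin P) ℝ) :
    ∑ i, h (beta α σ J i) =
      (sharpnessMatrix α σ J).trace - Real.log (sharpnessMatrix α σ J).det - P := by
  have h1 : (sharpnessMatrix α σ J).trace = ∑ i, beta α σ J i :=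
    (sharpnessMatrix_isHermitian α σ J).trace_eq_sum_eigenvalues
  have h2 : (sharpnessMatrix α σ J).det = ∏ i, beta α σ J i :=
    (sharpnessMatrix_isHermitian α σ J).det_eq_prod_eigenvalues
  rw [h1, h2, Real.log_prod fun i _ => (beta_pos α σ J i).ne']
  simp [h, Finset.sum_sub_distrib]

end Spectrum

/-! ### Dependence of the bound on the parameter scale -/

section ScaleDependence

/-- The network with two parameters whose outputs are all the product of the parameters. -/
def productNet (D K : ℕ) (_x : Vec D) (ψ : Vec 2) : Vec K :=
  (ψ 0 * ψ 1) • WithLp.toLp 2 fun _ => 1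

lemma contDiff_productNet (D K : ℕ) :
    ContDiff ℝ (⊤ : ℕ∞) (Function.uncurry (productNet D K)) := by
  have h : ∀ i : Fin 2, ContDiff ℝ (⊤ : ℕ∞) fun p : Vec D × Vec 2 => p.2 i := fun i =>
    (EuclideanSpace.proj (𝕜 := ℝ) i).contDiff.comp contDiff_snd
  exact ((h 0).mul (h 1)).smul contDiff_const

lemma isFunctionPreserving_productNet (D K : ℕ) :
    IsFunctionPreserving (productNet D K) ![2, 1 / 2] := by
  refine ⟨fun i => by fin_cases i <;> norm_num, fun x ψ => ?_⟩
  unfold productNet diagScale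
  congr 1
  simp
  ring

lemma jacobian_productNet {D K : ℕ} (x : Vec D) (c : ℝ) :
    jacobian (productNet D K) x (WithLp.toLp 2 ![0, c]) = Matrix.of fun _ p => ![c, 0] p := by
  have h : ∀ i : Fin 2, HasFDerivAt (fun ψ : Vec 2 => ψ i) (EuclideanSpace.proj (𝕜 := ℝ) i)
      (WithLp.toLp 2 ![0, c]) := fun i => (EuclideanSpace.proj (𝕜 := ℝ) i).hasFDerivAt
  have h1 : fderiv ℝ (productNet D K x) (WithLp.toLp 2 ![0, c]) = _ :=
    (((h 0).mul (h 1)).smul_const (WithLp.toLp 2 fun _ : Fin K => (1 : ℝ))).fderiv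
  ext k p
  rw [jacobian, Matrix.of_apply, h1]
  fin_cases p <;> simp

/-- Here JᵀJ is diagonal with entries |κ|c² and 0; the second direction has β' = 1 and contributes
h(1) = 0. -/
lemma sum_h_beta_of_row {κ : Type*} [Fintype κ] (α σ c : ℝ) :
    ∑ i, h (beta α σ (Matrix.of fun (_ : κ) (p : Fin 2) => ![c, 0] p) i) =
      h (1 + α ^ 2 / σ ^ 2 * (Fintype.card κ * c ^ 2))⁻¹ := by
  set a := α ^ 2 / σ ^ 2 * (Fintype.card κ * c ^ 2) with ha
  have ha0 : 0 ≤ a := by positivity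
  have h1 : sharpnessMatrix α σ (Matrix.of fun (_ : κ) (p : Fin 2) => ![c, 0] p) =
      Matrix.diagonal ![(1 + a)⁻¹, 1] := by
    refine Matrix.inv_eq_left_inv ?_
    have h2 : 1 + (α ^ 2 / σ ^ 2) • ((Matrix.of fun (_ : κ) (p : Fin 2) => ![c, 0] p).transpose *
        (Matrix.of fun (_ : κ) (p : Fin 2) => ![c, 0] p)) = Matrix.diagonal ![1 + a, 1] := by
      ext i j
      fin_cases i <;> fin_cases j <;> simp [Matrix.mul_apply, ha, sq]
    rw [h2, Matrix.diagonal_mul_diagonal]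
    ext i j
    have : (1 + a) ≠ 0 := by positivity
    fin_cases i <;> fin_cases j <;> simp [this]
  rw [sum_h_beta, h1, Matrix.trace_diagonal, Matrix.det_diagonal]
  simp [h]
  ring

/-- From log r < r - 1 at r = x/y, together with x/y ≤ 1 - (y - x), which uses y ≤ 1. -/
lemma h_strictAntiOn : StrictAntiOn h (Set.Ioc 0 1) := by
  intro x hx y hy hxy
  have h1 := Real.log_lt_sub_one_of_pos (div_pos hx.1 hy.1) (by
    rw [Ne, div_eq_one_iff_eq hy.1.ne']; exact hxy.ne)
  rw [Real.log_div hx.1.ne' hy.1.ne'] at h1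
  have h2 : x / y ≤ 1 - (y - x) := by
    rw [div_le_iff₀ hy.1]
    nlinarith [hx.1, hy.1, hy.2]
  unfold h
  linarith

/-- On zero data at (0, c) the network fits exactly: residual and posterior mean vanish, and with
zero error only the sharpness and confidence terms survive. -/
lemma upperBound_productNet {D K NP NQ : ℕ} (α σ δ c : ℝ) (R : Finset (Fin NP ⊕ Fin NQ)) :
    upperBound α σ δ (fun _ _ => 0) (productNet D K) R (fun _ => 0) (WithLp.toLp 2 ![0, c]) =
      Real.sqrt (h (1 + α ^ 2 / σ ^ 2 * (Fintype.card (R × Fin K) * c ^ 2))⁻¹ / (4 * NQ) +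
        Real.log (2 * Real.sqrt NQ / δ) / (2 * NQ)) := by
  have hJ : stackedJacobian (productNet D K) (subSample R fun _ => 0) (WithLp.toLp 2 ![0, c]) =
      Matrix.of fun (_ : R × Fin K) (p : Fin 2) => ![c, 0] p := by
    ext i p
    simp [stackedJacobian, jacobian_productNet]
  have hr : residual (productNet D K) (subSample R fun _ => 0) (WithLp.toLp 2 ![0, c]) = 0 := by
    ext i
    simp [residual, productNet, subSample]
  simp only [upperBound, hJ, hr, ← Finset.sum_div, sum_h_beta_of_row]
  simp [empError, posteriorMean]

lemma exists_upperBound_ne {D K NP NQ : ℕ} (hNQ : 0 < NQ) {α σ δ : ℝ} (hα : 0 < α) (hσ : 0 < σ)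
    (hδ : 0 < δ) (hδ' : δ ≤ 1) {R : Finset (Fin NP ⊕ Fin NQ)} (hK : 0 < K) (hR : R.Nonempty) :
    ∃ (P' : ℕ) (f' : Vec D → Vec P' → Vec K) (err' : Vec K → Vec K → ℝ) (t : Fin P' → ℝ)
      (s : Fin NP ⊕ Fin NQ → Vec D × Vec K) (θ' : Vec P'),
      ContDiff ℝ (⊤ : ℕ∞) (Function.uncurry f') ∧
      Measurable (Function.uncurry err') ∧ (∀ a b, err' a b ∈ Set.Icc (0 : ℝ) 1) ∧
      IsFunctionPreserving f' t ∧
      upperBound α σ δ err' f' R s (diagScale t θ') ≠ upperBound α σ δ err' f' R s θ' := by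
  -- The scaling (2, 1/2) moves (0, 1) to (0, 1/2): the output stays 0, but the gradient shrinks
  -- from (1, 0) to (1/2, 0).
  refine ⟨2, productNet D K, fun _ _ => 0, ![2, 1 / 2], fun _ => 0, WithLp.toLp 2 ![0, 1],
    contDiff_productNet D K, measurable_const, fun _ _ => by simp,
    isFunctionPreserving_productNet D K, ?_⟩
  have hscale : diagScale ![2, 1 / 2] (WithLp.toLp 2 ![0, 1]) =
      (WithLp.toLp 2 ![0, 1 / 2] : Vec 2) := by
    ext i
    fin_cases i <;> simp [diagScale]
  have hN : (0 : ℝ) < NQ := by exact_mod_cast hNQ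
  have hN1 : 1 ≤ Real.sqrt NQ := Real.one_le_sqrt.2 (by exact_mod_cast hNQ)
  -- Non-negativity of the radicand is needed, since `Real.sqrt` is constant on negative numbers; δ
  -- ≤ 1 makes the logarithm non-negative.
  have hL : 0 ≤ Real.log (2 * Real.sqrt NQ / δ) / (2 * NQ) := by
    refine div_nonneg (Real.log_nonneg ?_) (by positivity)
    rw [le_div_iff₀ hδ]
    linarith
  have hcard : (0 : ℝ) < Fintype.card (R × Fin K) := by
    have : Nonempty R := hR.to_subtype
    have : Nonempty (Fin K) := ⟨⟨0, hK⟩⟩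
    exact_mod_cast Fintype.card_pos
  rw [hscale, upperBound_productNet, upperBound_productNet]
  set n : ℝ := (Fintype.card (R × Fin K) : ℝ)
  have hmem : ∀ c : ℝ, (1 + α ^ 2 / σ ^ 2 * (n * c ^ 2))⁻¹ ∈ Set.Ioc (0 : ℝ) 1 := fun c => by
    have : 0 ≤ α ^ 2 / σ ^ 2 * (n * c ^ 2) := by positivity
    exact ⟨by positivity, inv_le_one_of_one_le₀ (by linarith)⟩
  have hlt : (1 + α ^ 2 / σ ^ 2 * (n * 1 ^ 2))⁻¹ < (1 + α ^ 2 / σ ^ 2 * (n * (1 / 2) ^ 2))⁻¹ := by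
    gcongr
    norm_num
  have hh := h_strictAntiOn (hmem 1) (hmem (1 / 2)) hlt
  refine (Real.sqrt_lt_sqrt (add_nonneg (div_nonneg (h_nonneg (hmem _).1) (by positivity)) hL)
    ?_).ne
  gcongr

end ScaleDependence

/-! ### Errors as posterior means of the risk gap -/

section Errors

variable {D P K N : ℕ} {f : Vec D → Vec P → Vec K} {err : Vec K → Vec K → ℝ}
  {𝒟 : Measure (Vec D × Vec K)} [IsProbabilityMeasure 𝒟]

lemma measurable_loss (hf : Measurable (Function.uncurry f))
    (herr : Measurable (Function.uncurry err)) :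
    Measurable (Function.uncurry fun (θ : Vec P) (z : Vec D × Vec K) => err (f z.1 θ) z.2) := by
  have h1 : Measurable fun q : Vec P × (Vec D × Vec K) => f q.2.1 q.1 :=
    hf.comp (measurable_snd.fst.prodMk measurable_fst)
  exact herr.comp (h1.prodMk measurable_snd.snd)

/-- Fubini: averaging over the perturbation last exhibits the difference of errors as the quantity
that the PAC-Bayes event controls. -/
lemma genError_sub_empError (hf : Measurable (Function.uncurry f))
    (herr : Measurable (Function.uncurry err)) (herr01 : ∀ a b, err a b ∈ Set.Icc (0 : ℝ) 1)
    (z : Fin N → Vec D × Vec K) (θ : Vec P) (Q : Measure (Vec P)) [IsProbabilityMeasure Q] :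
    genError err f 𝒟 θ Q - empError err f z θ Q =
      ∫ v, riskGap (fun θ z => err (f z.1 θ) z.2) 𝒟 z (θ + v) ∂Q := by
  have hm := measurable_loss hf herr
  have hshift : Measurable fun q : (Vec D × Vec K) × Vec P => (θ + q.2, q.1) :=
    (measurable_snd.const_add θ).prodMk measurable_fst
  have hprod : Measurable fun q : (Vec D × Vec K) × Vec P =>
      err (f q.1.1 (θ + q.2)) q.1.2 := hm.comp hshift
  have hint := integrable_of_mem_Icc (ν := 𝒟.prod Q) hprod fun q => herr01 _ _
  have hterm : ∀ n, Integrable (fun v => err (f (z n).1 (θ + v)) (z n).2) Q := fun n =>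
    integrable_of_mem_Icc (hprod.comp (measurable_const (a := z n) |>.prodMk measurable_id))
      fun v => herr01 _ _
  unfold riskGap genError empError
  rw [integral_sub hint.integral_prod_right
      ((integrable_finsetSum _ fun n _ => hterm n).const_mul _), integral_prod_symm _ hint,
    integral_const_mul, integral_finsetSum _ fun n _ => hterm n]

end Errors

end PacBayesNTK

end

open PacBayesNTK in
/-- PAC-Bayes-NTK. `S` is the i.i.d. training data, split into `S_P` (left indices) and `S_Q`
(right indices); `θ` is the parameter pre-trained on `S_P` (possibly by a randomized algorithm), so
it is independent of `S_Q`; the posterior is built from the data with index in `R`, which may be the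
whole data set, or `S_Q`. -/
theorem mainTheorem7 {D P K NP NQ : ℕ} (hNQ : 0 < NQ)
    {α σ δ : ℝ} (hα : 0 < α) (hσ : 0 < σ) (hδ : 0 < δ) (hδ' : δ ≤ 1)
    (f : Vec D → Vec P → Vec K) (hf : Measurable (Function.uncurry f))
    (err : Vec K → Vec K → ℝ) (herr : Measurable (Function.uncurry err))
    (herr01 : ∀ a b, err a b ∈ Set.Icc (0 : ℝ) 1)
    (𝒟 : Measure (Vec D × Vec K)) [IsProbabilityMeasure 𝒟]
    {Ω : Type*} [MeasurableSpace Ω] (μ : Measure Ω) [IsProbabilityMeasure μ]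
    (S : Fin NP ⊕ Fin NQ → Ω → Vec D × Vec K) (hS : ∀ i, Measurable (S i))
    (hSindep : iIndepFun S μ) (hSlaw : ∀ i, μ.map (S i) = 𝒟)
    (θ : Ω → Vec P) (hθ : Measurable θ)
    (hθindep : IndepFun θ (fun ω (n : Fin NQ) => S (Sum.inr n) ω) μ)
    (R : Finset (Fin NP ⊕ Fin NQ))
    (hdiff : ∀ᵐ ω ∂μ, ∀ i ∈ R, DifferentiableAt ℝ (f (S i ω).1) (θ ω)) :
    -- the bound holds with probability at least `1 - δ`
    (∃ G : Set Ω, MeasurableSet G ∧ ENNReal.ofReal (1 - δ) ≤ μ G ∧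
      ∀ ω ∈ G,
        genError err f 𝒟 (θ ω) (posterior α σ f (subSample R (S · ω)) (θ ω)) ≤
          upperBound α σ δ err f R (S · ω) (θ ω)) ∧
    -- perturbation and sharpness terms form the KL divergence; the `β'_i` in terms of the NTK
    (∀ᵐ ω ∂μ,
      let z := subSample R (S · ω)
      let J := stackedJacobian f z (θ ω)
      let m := posteriorMean α σ J (residual f z (θ ω))
      klDiv (posterior α σ f z (θ ω)) (prior P α) =
          ENNReal.ofReal (dotProduct m m / (2 * α ^ 2) + (∑ i, h (beta α σ J i) / 2)) ∧
        ∃ lam : Fin P → ℝ,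
          (∀ x : ℝ, x ≠ 0 → {i | lam i = x}.ncard = {j | ntkEigenvalues J j = x}.ncard) ∧
          ∀ i, beta α σ J i = σ ^ 2 / (σ ^ 2 + α ^ 2 * lam i)) ∧
    -- the bound is not invariant under function-preserving scale transformations in general
    (0 < K → R.Nonempty →
      ∃ (P' : ℕ) (f' : Vec D → Vec P' → Vec K) (err' : Vec K → Vec K → ℝ) (t : Fin P' → ℝ)
        (s : Fin NP ⊕ Fin NQ → Vec D × Vec K) (θ' : Vec P'),
        ContDiff ℝ (⊤ : ℕ∞) (Function.uncurry f') ∧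
        Measurable (Function.uncurry err') ∧ (∀ a b, err' a b ∈ Set.Icc (0 : ℝ) 1) ∧
        IsFunctionPreserving f' t ∧
        upperBound α σ δ err' f' R s (diagScale t θ') ≠ upperBound α σ δ err' f' R s θ') := by
  have : IsProbabilityMeasure (prior P α) := by unfold prior; infer_instance
  have hNQ' : (0 : ℝ) < NQ := by exact_mod_cast hNQ
  refine ⟨?_, .of_forall fun ω => ⟨?_, ?_⟩, fun hK hR =>
    exists_upperBound_ne hNQ hα hσ hδ hδ' hK hR⟩
  · obtain ⟨G, hG, hGμ, hGb⟩ := exists_pacBayes_event (𝒟 := 𝒟) hNQ (measurable_loss hf herr)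
      (fun θ z => herr01 _ _) hδ (prior P α) μ (fun n => hS (Sum.inr n))
      (hSindep.precomp Sum.inr_injective) (fun n => hSlaw (Sum.inr n)) hθ hθindep
    refine ⟨G, hG, hGμ, fun ω hω => ?_⟩
    set z := subSample R (S · ω) with hz
    have hKL := klDiv_multivariateGaussian_prior (σ := σ) hα (stackedJacobian f z (θ ω))
      (posteriorMean α σ (stackedJacobian f z (θ ω)) (residual f z (θ ω)))
    have : IsProbabilityMeasure (PacBayesNTK.posterior α σ f z (θ ω)) := by
      unfold PacBayesNTK.posterior
      infer_instance
    -- The event was fixed before any posterior, so the one built from the data at `ω` is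
    -- admissible; only its finite divergence has to be checked.
    have hb := hGb ω hω (PacBayesNTK.posterior α σ f z (θ ω)) (by
      rw [PacBayesNTK.posterior, hKL]
      exact ENNReal.ofReal_ne_top)
    rw [← genError_sub_empError hf herr herr01, sub_le_iff_le_add'] at hb
    refine hb.trans_eq ?_
    rw [upperBound]
    congr 2
    -- Dividing the divergence by 2N turns its factors 1/2 into the 1/4 of the bound; `toReal`
    -- recovers the formula because that is non-negative.
    rw [PacBayesNTK.posterior, hKL, ENNReal.toReal_ofReal]
    · simp_rw [← Finset.sum_div]
      field_simp
      ring
    · refine add_nonneg (div_nonneg ?_ (by positivity)) (Finset.sum_nonneg fun i _ => ?_)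
      · exact Finset.sum_nonneg fun i _ => mul_self_nonneg _
      · exact div_nonneg (h_nonneg (beta_pos _ _ _ _)) zero_le_two
  · exact klDiv_multivariateGaussian_prior hα _ _
  · exact exists_ntk_eigenvalues hα hσ _
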